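/- Let $\mu,\nu>0$. Let $\alpha_k,\beta_k,\gamma_k,\delta_k$ ($k=1,2,\dots$) be mutually independent random variables such that, for every $k$, $\alpha_k$ and $\delta_k$ are exponentially distributed with parameter (rate) $\mu$, and $\beta_k$ and $\gamma_k$ are exponentially distributed with parameter $\nu$. (This is the second-order exponential system whose entries $\alpha_k,\beta_k,\gamma_k,\delta_k$ have parameters $\mu,\nu,\sigma,\tau$, in the case $\tau=\mu$, $\sigma=\nu$.) Put $x(0)=y(0)=0$ and, for $k\ge 1$, $$x(k)=\max\bigl(x(k-1)+\alpha_k,\;y(k-1)+\beta_k\bigr),\qquad y(k)=\max\bigl(x(k-1)+\gamma_k,\;y(k-1)+\delta_k\bigr).$$ Then, almost surely, the Lyapunov exponent $$\lambda=\lim_{k\to\infty}\frac1k\max\bigl(x(k),y(k)\bigr)$$ exists and equals $$\lambda=\frac{P(\mu,\nu)}{Q(\mu,\nu)},$$ where \begin{align*} P(\mu,\nu)&=160\mu^{10}+1776\mu^{9}\nu+8220\mu^{8}\nu^{2}+21378\mu^{7}\nu^{3}+35595\mu^{6}\nu^{4}+41566\mu^{5}\nu^{5}\\ &\qquad+35595\mu^{4}\nu^{6}+21378\mu^{3}\nu^{7}+8220\mu^{2}\nu^{8}+1776\mu\nu^{9}+160\nu^{10},\\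 Q(\mu,\nu)&=16\mu\nu(\mu+\nu)\bigl(8\mu^{8}+80\mu^{7}\nu+321\mu^{6}\nu^{2}+690\mu^{5}\nu^{3}+880\mu^{4}\nu^{4}\\ &\qquad+690\mu^{3}\nu^{5}+321\mu^{2}\nu^{6}+80\mu\nu^{7}+8\nu^{8}\bigr). \end{align*} -/

import Mathlib

open MeasureTheory ProbabilityTheory Filter Topology

namespace MaxPlus

/-- The entries of the state transition matrices of a general second-order exponential system.
The variable `α k` is the entry `α_{k+1}` of the matrix `A(k+1)`, for `k = 0, 1, 2, …`, and
likewise for `β`, `γ`, `δ`. All entries of all matrices are mutually independent, and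
`α_k, β_k, γ_k, δ_k` are exponential with the rates `μ, ν, σ, τ`. -/
structure IsExponentialSystem {Ω : Type*} [MeasurableSpace Ω] (P : Measure Ω)
    (μ ν σ τ : ℝ) (α β γ δ : ℕ → Ω → ℝ) : Prop where
  law_α : ∀ k, HasLaw (α k) (expMeasure μ) P
  law_β : ∀ k, HasLaw (β k) (expMeasure ν) P
  law_γ : ∀ k, HasLaw (γ k) (expMeasure σ) P
  law_δ : ∀ k, HasLaw (δ k) (expMeasure τ) P
  indep : iIndepFun (fun (i : Fin 4 × ℕ) => (![α, β, γ, δ] i.1) i.2) P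

/-- The state vector `z(k) = (x(k), y(k))`: `z(0) = (0, 0)` and `z(k+1) = A(k+1) z(k)`, where the
product of the matrix with rows `(α, β)`, `(γ, δ)` and a vector is taken in the semiring with
the operations maximum and addition. -/
noncomputable def state {Ω : Type*} (α β γ δ : ℕ → Ω → ℝ) : ℕ → Ω → ℝ × ℝ
  | 0, _ => (0, 0)
  | k + 1, ω =>
    (max ((state α β γ δ k ω).1 + α k ω) ((state α β γ δ k ω).2 + β k ω),
     max ((state α β γ δ k ω).1 + γ k ω) ((state α β γ δ k ω).2 + δ k ω))

/-- `l` is the Lyapunov exponent of the system: `max (x(k), y(k)) / k` tends to `l` as `k → ∞`,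
almost surely. -/
def IsLyapunovExponent {Ω : Type*} [MeasurableSpace Ω] (P : Measure Ω)
    (α β γ δ : ℕ → Ω → ℝ) (l : ℝ) : Prop :=
  ∀ᵐ ω ∂P, Tendsto
    (fun k : ℕ => (1 / (k : ℝ)) * max (state α β γ δ k ω).1 (state α β γ δ k ω).2)
    atTop (𝓝 l)

/-- The numerator. -/
def numP (μ ν : ℝ) : ℝ :=
  160 * μ ^ 10 + 1776 * μ ^ 9 * ν + 8220 * μ ^ 8 * ν ^ 2 + 21378 * μ ^ 7 * ν ^ 3
    + 35595 * μ ^ 6 * ν ^ 4 + 41566 * μ ^ 5 * ν ^ 5 + 35595 * μ ^ 4 * ν ^ 6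
    + 21378 * μ ^ 3 * ν ^ 7 + 8220 * μ ^ 2 * ν ^ 8 + 1776 * μ * ν ^ 9 + 160 * ν ^ 10

/-- The denominator. -/
def denQ (μ ν : ℝ) : ℝ :=
  16 * μ * ν * (μ + ν) *
    (8 * μ ^ 8 + 80 * μ ^ 7 * ν + 321 * μ ^ 6 * ν ^ 2 + 690 * μ ^ 5 * ν ^ 3
      + 880 * μ ^ 4 * ν ^ 4 + 690 * μ ^ 3 * ν ^ 5 + 321 * μ ^ 2 * ν ^ 6 + 80 * μ * ν ^ 7
      + 8 * ν ^ 8)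

end MaxPlus

/-! A corrector `h`, bounded on `[0, ∞)`, is added to `max x y`, evaluated at `r = |x - y|`, so that
every step raises the sum by the same constant `λ` on average, whatever the current state is (a
Poisson equation). Relative to the larger coordinate, a coordinate of the next state is a maximum of
two exponential variables, one of them shifted by `r`. The law of this maximum is a signed mixture
of exponential laws whose weights are exponentials in `r`, so `h` can be sought among the
combinations of `exp (-(μ * r))`, `exp (-(ν * r))` and `exp (-((μ + ν) * r))`. This leaves a finite
linear system, whose solution gives `λ = numP μ ν / denQ μ ν`. The corrected maximum minus `n * λ`
is then a martingale with bounded second moments of its increments. It is therefore `o(n)` along the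
squares, almost surely, and monotonicity of the maximum fills the gaps between the squares. -/

namespace MaxPlus

section ExponentialLaw

variable {a b c t : ℝ}

lemma measurable_exponentialPDF (a : ℝ) : Measurable (exponentialPDF a) :=
  (measurable_exponentialPDFReal a).ennreal_ofReal

instance sFinite_expMeasure (a : ℝ) : SFinite (expMeasure a) :=
  inferInstanceAs (SFinite (volume.withDensity (exponentialPDF a)))

lemma toReal_exponentialPDF_smul (ha : 0 < a) (f : ℝ → ℝ) :
    (fun x => (exponentialPDF a x).toReal • f x)
      = (Set.Ici (0 : ℝ)).indicator fun x => a * Real.exp (-(a * x)) * f x := by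
  funext x
  by_cases hx : 0 ≤ x
  · rw [exponentialPDF_of_nonneg hx, ENNReal.toReal_ofReal (by positivity),
      Set.indicator_of_mem (Set.mem_Ici.2 hx), smul_eq_mul]
  · rw [exponentialPDF_of_neg (not_le.1 hx), Set.indicator_of_notMem (by simpa using hx),
      ENNReal.toReal_zero, zero_smul]

lemma integral_expMeasure (ha : 0 < a) (f : ℝ → ℝ) :
    ∫ x, f x ∂expMeasure a = ∫ x in Set.Ioi 0, a * Real.exp (-(a * x)) * f x := by
  change ∫ x, f x ∂volume.withDensity (exponentialPDF a) = _
  rw [integral_withDensity_eq_integral_toReal_smul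
    (measurable_exponentialPDF a) (ae_of_all _ fun _ => ENNReal.ofReal_lt_top),
    toReal_exponentialPDF_smul ha, integral_indicator measurableSet_Ici,
    integral_Ici_eq_integral_Ioi]

lemma integrable_expMeasure_iff (ha : 0 < a) (f : ℝ → ℝ) :
    Integrable f (expMeasure a)
      ↔ IntegrableOn (fun x => a * Real.exp (-(a * x)) * f x) (Set.Ioi 0) := by
  change Integrable f (volume.withDensity (exponentialPDF a)) ↔ _
  rw [integrable_withDensity_iff_integrable_smul'
    (measurable_exponentialPDF a) (ae_of_all _ fun _ => ENNReal.ofReal_lt_top),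
    toReal_exponentialPDF_smul ha, integrable_indicator_iff measurableSet_Ici,
    integrableOn_Ici_iff_integrableOn_Ioi]

lemma measureReal_expMeasure_Iic (ha : 0 < a) (t : ℝ) :
    (expMeasure a).real (Set.Iic t) = if 0 ≤ t then 1 - Real.exp (-(a * t)) else 0 := by
  have := isProbabilityMeasure_expMeasure ha
  rw [← cdf_eq_real, cdf_expMeasure_eq ha]

lemma expMeasure_Ioi (ha : 0 < a) (ht : 0 ≤ t) :
    expMeasure a (Set.Ioi t) = ENNReal.ofReal (Real.exp (-(a * t))) := by
  have := isProbabilityMeasure_expMeasure ha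
  rw [← ofReal_measureReal, ← Set.compl_Iic, probReal_compl_eq_one_sub measurableSet_Iic,
    measureReal_expMeasure_Iic ha, if_pos ht, sub_sub_cancel]

lemma ae_nonneg_expMeasure (ha : 0 < a) : ∀ᵐ x ∂expMeasure a, 0 ≤ x := by
  have := isProbabilityMeasure_expMeasure ha
  have h_pos : ∀ᵐ x ∂expMeasure a, x ∈ Set.Ioi (0 : ℝ) :=
    (mem_ae_iff_prob_eq_one measurableSet_Ioi).2 (by simp [expMeasure_Ioi ha le_rfl])
  exact h_pos.mono fun x hx => (Set.mem_Ioi.1 hx).le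

lemma memLp_id_expMeasure (ha : 0 < a) : MemLp (fun x : ℝ => x) 2 (expMeasure a) := by
  rw [memLp_two_iff_integrable_sq (by fun_prop), integrable_expMeasure_iff ha]
  have h := integrableOn_rpow_mul_exp_neg_mul_rpow (p := 1) (s := 2) (b := a) (by norm_num)
    one_pos ha
  refine IntegrableOn.congr_fun (h.const_mul a) (fun x _ => ?_) measurableSet_Ioi
  simp only [Real.rpow_one, Real.rpow_ofNat, neg_mul]
  ring

lemma integrable_id_expMeasure (ha : 0 < a) : Integrable (fun x : ℝ => x) (expMeasure a) :=
  have := isProbabilityMeasure_expMeasure ha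
  (memLp_id_expMeasure ha).integrable (by norm_num)

lemma integral_id_expMeasure (ha : 0 < a) : ∫ x, x ∂expMeasure a = 1 / a := by
  rw [integral_expMeasure ha]
  calc ∫ x in Set.Ioi 0, a * Real.exp (-(a * x)) * x
      = ∫ x in Set.Ioi 0, a * (x ^ ((2 : ℝ) - 1) * Real.exp (-(a * x))) := by
        refine setIntegral_congr_fun measurableSet_Ioi fun x _ => ?_
        norm_num
        ring
    _ = 1 / a := by
        rw [integral_const_mul, Real.integral_rpow_mul_exp_neg_mul_Ioi two_pos ha]
        norm_num
        field_simp

lemma integrable_expMeasure_of_abs_le (ha : 0 < a) {h : ℝ → ℝ} (hm : Measurable h) {C : ℝ}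
    (hC : ∀ r, 0 ≤ r → |h r| ≤ C) : Integrable h (expMeasure a) :=
  have := isProbabilityMeasure_expMeasure ha
  .mono' (integrable_const C) hm.aestronglyMeasurable ((ae_nonneg_expMeasure ha).mono hC)

lemma abs_exp_neg_mul_le_one (hc : 0 ≤ c) (ht : 0 ≤ t) : |Real.exp (-(c * t))| ≤ 1 := by
  rw [Real.abs_exp, Real.exp_le_one_iff, neg_nonpos]
  positivity

lemma integrable_exp_neg_expMeasure (ha : 0 < a) (hc : 0 ≤ c) :
    Integrable (fun x => Real.exp (-(c * x))) (expMeasure a) :=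
  integrable_expMeasure_of_abs_le ha (by fun_prop) fun _ => abs_exp_neg_mul_le_one hc

lemma integral_exp_neg_expMeasure (ha : 0 < a) (hc : 0 ≤ c) :
    ∫ x, Real.exp (-(c * x)) ∂expMeasure a = a / (a + c) := by
  rw [integral_expMeasure ha]
  calc ∫ x in Set.Ioi 0, a * Real.exp (-(a * x)) * Real.exp (-(c * x))
      = ∫ x in Set.Ioi 0, a * Real.exp (-(a + c) * x) := by
        refine setIntegral_congr_fun measurableSet_Ioi fun x _ => ?_
        simp only [mul_assoc, ← Real.exp_add]
        ring_nf
    _ = a / (a + c) := by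
        rw [integral_const_mul, integral_exp_mul_Ioi (by linarith), mul_zero, Real.exp_zero,
          neg_div_neg_eq, mul_one_div]

lemma measure_prod_expMeasure_add_lt (ha : 0 < a) (hb : 0 < b) (ht : 0 ≤ t) :
    (expMeasure a).prod (expMeasure b) {z | z.2 + t < z.1}
      = ENNReal.ofReal (b / (a + b) * Real.exp (-(a * t))) := by
  have h_section : ∀ᵐ y ∂expMeasure b, expMeasure a ((fun x => (x, y)) ⁻¹' {z | z.2 + t < z.1})
      = ENNReal.ofReal (Real.exp (-(a * t)) * Real.exp (-(a * y))) := by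
    filter_upwards [ae_nonneg_expMeasure hb] with y hy
    change expMeasure a (Set.Ioi (y + t)) = _
    rw [expMeasure_Ioi ha (by positivity), ← Real.exp_add]
    ring_nf
  rw [Measure.prod_apply_symm (measurableSet_lt (by fun_prop) (by fun_prop)),
    lintegral_congr_ae h_section, ← ofReal_integral_eq_lintegral_ofReal
      ((integrable_exp_neg_expMeasure hb ha.le).const_mul _) (ae_of_all _ fun _ => by positivity),
    integral_const_mul, integral_exp_neg_expMeasure hb ha.le, mul_comm, add_comm b]

lemma measure_prod_expMeasure_lt_abs_sub (ha : 0 < a) (hb : 0 < b) (ht : 0 ≤ t) :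
    (expMeasure a).prod (expMeasure b) {z | t < |z.1 - z.2|}
      = ENNReal.ofReal (b / (a + b) * Real.exp (-(a * t)) + a / (a + b) * Real.exp (-(b * t))) := by
  have h_union : {z : ℝ × ℝ | t < |z.1 - z.2|} = {z | z.2 + t < z.1} ∪ {z | z.1 + t < z.2} := by
    ext z
    simp only [Set.mem_ofPred_eq, Set.mem_union, lt_abs, neg_sub, lt_sub_iff_add_lt']
  have h_disjoint : Disjoint {z : ℝ × ℝ | z.2 + t < z.1} {z | z.1 + t < z.2} :=
    Set.disjoint_left.2 fun z (h₁ : z.2 + t < z.1) (h₂ : z.1 + t < z.2) => by linarith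
  have h_swap : (expMeasure a).prod (expMeasure b) {z | z.1 + t < z.2}
      = ENNReal.ofReal (a / (a + b) * Real.exp (-(b * t))) := by
    rw [← Measure.prod_swap, Measure.map_apply measurable_swap
      (measurableSet_lt (by fun_prop) (by fun_prop)), add_comm a]
    exact measure_prod_expMeasure_add_lt hb ha ht
  rw [h_union, measure_union h_disjoint (measurableSet_lt (by fun_prop) (by fun_prop)),
    measure_prod_expMeasure_add_lt ha hb ht, h_swap, ENNReal.ofReal_add (by positivity)
      (by positivity)]

/- By absence of memory, `X - Y` has law `expMeasure a` on the event `Y < X`, whose probability is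
`b / (a + b)`. -/
lemma map_abs_sub_prod_expMeasure (ha : 0 < a) (hb : 0 < b) :
    ((expMeasure a).prod (expMeasure b)).map (fun z => |z.1 - z.2|)
      = (b / (a + b)).toNNReal • expMeasure a + (a / (a + b)).toNNReal • expMeasure b := by
  have := isProbabilityMeasure_expMeasure ha
  have := isProbabilityMeasure_expMeasure hb
  have := Measure.isProbabilityMeasure_map (μ := (expMeasure a).prod (expMeasure b))
    (f := fun z => |z.1 - z.2|) (by fun_prop)
  refine Measure.ext_of_Iic _ _ fun t => (measureReal_eq_measureReal_iff).1 ?_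
  rw [measureReal_add_apply, measureReal_nnreal_smul_apply, measureReal_nnreal_smul_apply,
    measureReal_expMeasure_Iic ha, measureReal_expMeasure_Iic hb,
    Real.coe_toNNReal _ (by positivity), Real.coe_toNNReal _ (by positivity)]
  rcases le_or_gt 0 t with ht | ht
  · rw [← compl_compl (Set.Iic t), Set.compl_Iic, probReal_compl_eq_one_sub measurableSet_Ioi,
      map_measureReal_apply (by fun_prop) measurableSet_Ioi, measureReal_def]
    change 1 - ((expMeasure a).prod (expMeasure b) {z | t < |z.1 - z.2|}).toReal = _
    rw [measure_prod_expMeasure_lt_abs_sub ha hb ht, ENNReal.toReal_ofReal (by positivity),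
      if_pos ht, if_pos ht]
    field_simp
    ring
  · have h_empty : (fun z : ℝ × ℝ => |z.1 - z.2|) ⁻¹' Set.Iic t = ∅ :=
      Set.eq_empty_of_forall_notMem fun z hz => (ht.trans_le (abs_nonneg _)).not_ge hz
    rw [map_measureReal_apply (by fun_prop) measurableSet_Iic, h_empty, if_neg ht.not_ge,
      if_neg ht.not_ge, measureReal_empty, mul_zero, mul_zero, add_zero]

lemma integral_comp_abs_sub_prod_expMeasure (ha : 0 < a) (hb : 0 < b) {h : ℝ → ℝ}
    (h_a : Integrable h (expMeasure a)) (h_b : Integrable h (expMeasure b)) :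
    ∫ z, h |z.1 - z.2| ∂(expMeasure a).prod (expMeasure b)
      = (b * ∫ x, h x ∂expMeasure a + a * ∫ x, h x ∂expMeasure b) / (a + b) := by
  have h_map : Integrable h (((expMeasure a).prod (expMeasure b)).map fun z => |z.1 - z.2|) := by
    rw [map_abs_sub_prod_expMeasure ha hb]
    exact h_a.smul_measure_nnreal.add_measure h_b.smul_measure_nnreal
  rw [← integral_map (φ := fun z : ℝ × ℝ => |z.1 - z.2|) (by fun_prop) h_map.1,
    map_abs_sub_prod_expMeasure ha hb,
    integral_add_measure h_a.smul_measure_nnreal h_b.smul_measure_nnreal,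
    integral_smul_nnreal_measure, integral_smul_nnreal_measure, NNReal.smul_def, NNReal.smul_def,
    Real.coe_toNNReal _ (by positivity), Real.coe_toNNReal _ (by positivity), smul_eq_mul,
    smul_eq_mul]
  ring

end ExponentialLaw

section SignedMixture

variable {E : Type*} [MeasurableSpace E] {m m₀ m₁ m₂ : Measure E} {c : NNReal} {f : E → ℝ}

lemma integrable_of_add_smul_eq (h : m + c • m₀ = m₁ + c • m₂) (h₁ : Integrable f m₁)
    (h₂ : Integrable f m₂) : Integrable f m :=
  (h ▸ h₁.add_measure h₂.smul_measure_nnreal : Integrable f (m + c • m₀)).left_of_add_measure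

lemma integral_of_add_smul_eq (h : m + c • m₀ = m₁ + c • m₂) (h₀ : Integrable f m₀)
    (h₁ : Integrable f m₁) (h₂ : Integrable f m₂) :
    ∫ x, f x ∂m = ∫ x, f x ∂m₁ + c * (∫ x, f x ∂m₂ - ∫ x, f x ∂m₀) := by
  have h_eq : ∫ x, f x ∂(m + c • m₀) = ∫ x, f x ∂(m₁ + c • m₂) := by rw [h]
  rw [integral_add_measure (integrable_of_add_smul_eq h h₁ h₂) h₀.smul_measure_nnreal,
    integral_add_measure h₁ h₂.smul_measure_nnreal, integral_smul_nnreal_measure,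
    integral_smul_nnreal_measure, NNReal.smul_def, NNReal.smul_def, smul_eq_mul, smul_eq_mul]
    at h_eq
  linarith

variable {F : Type*} [MeasurableSpace F] (n : Measure F) [SFinite n] [SFinite m] [SFinite m₀]
  [SFinite m₁] [SFinite m₂]

lemma add_smul_prod_eq (h : m + c • m₀ = m₁ + c • m₂) :
    m.prod n + c • m₀.prod n = m₁.prod n + c • m₂.prod n := by
  have h_prod := congrArg (Measure.prod · n) h
  simpa only [Measure.add_prod, Measure.prod_smul_left] using h_prod

lemma prod_add_smul_eq (h : m + c • m₀ = m₁ + c • m₂) :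
    n.prod m + c • n.prod m₀ = n.prod m₁ + c • n.prod m₂ := by
  have h_prod := congrArg (Measure.prod n) h
  simpa only [Measure.prod_add, Measure.prod_smul_right] using h_prod

end SignedMixture

section MaxLaw

variable {a b a' b' d : ℝ}

/-- The law of `max (X - d) Y` for independent `X` and `Y` that are exponential with the rates `a`
and `b`: the law of a coordinate of the next state, relative to the larger coordinate of a state
whose coordinates differ by `d`. -/
noncomputable def maxLaw (a b d : ℝ) : Measure ℝ :=
  ((expMeasure a).prod (expMeasure b)).map fun z => max (z.1 - d) z.2

instance sFinite_maxLaw (a b d : ℝ) : SFinite (maxLaw a b d) :=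
  inferInstanceAs (SFinite (Measure.map _ _))

lemma isProbabilityMeasure_maxLaw (ha : 0 < a) (hb : 0 < b) (d : ℝ) :
    IsProbabilityMeasure (maxLaw a b d) :=
  have := isProbabilityMeasure_expMeasure ha
  have := isProbabilityMeasure_expMeasure hb
  Measure.isProbabilityMeasure_map (by fun_prop)

lemma measureReal_maxLaw_Iic (a b d t : ℝ) :
    (maxLaw a b d).real (Set.Iic t)
      = (expMeasure a).real (Set.Iic (t + d)) * (expMeasure b).real (Set.Iic t) := by
  have h_preimage : (fun z : ℝ × ℝ => max (z.1 - d) z.2) ⁻¹' Set.Iic t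
      = Set.Iic (t + d) ×ˢ Set.Iic t := by
    ext z
    simp only [Set.mem_preimage, Set.mem_Iic, Set.mem_prod, max_le_iff, sub_le_iff_le_add]
  rw [maxLaw, map_measureReal_apply (by fun_prop) measurableSet_Iic, h_preimage,
    measureReal_prod_prod]

/- With distribution functions `1 - exp (-(a * t))`, this is the expansion of a product: the product
of two exponentials is an exponential whose rate is the sum. -/
lemma maxLaw_add_smul (ha : 0 < a) (hb : 0 < b) (hd : 0 ≤ d) :
    maxLaw a b d + (Real.exp (-(a * d))).toNNReal • expMeasure (a + b)
      = expMeasure b + (Real.exp (-(a * d))).toNNReal • expMeasure a := by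
  have := isProbabilityMeasure_expMeasure ha
  have := isProbabilityMeasure_expMeasure hb
  have := isProbabilityMeasure_expMeasure (add_pos ha hb)
  have := isProbabilityMeasure_maxLaw ha hb d
  refine Measure.ext_of_Iic _ _ fun t => (measureReal_eq_measureReal_iff).1 ?_
  rw [measureReal_add_apply, measureReal_add_apply, measureReal_nnreal_smul_apply,
    measureReal_nnreal_smul_apply, measureReal_maxLaw_Iic, measureReal_expMeasure_Iic ha,
    measureReal_expMeasure_Iic ha, measureReal_expMeasure_Iic hb,
    measureReal_expMeasure_Iic (add_pos ha hb), Real.coe_toNNReal _ (Real.exp_pos _).le]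
  rcases le_or_gt 0 t with ht | ht
  · rw [if_pos (add_nonneg ht hd), if_pos ht, if_pos ht, if_pos ht, mul_add a t d,
      add_mul a b t, neg_add, neg_add, Real.exp_add, Real.exp_add]
    ring
  · rw [if_neg ht.not_ge, if_neg ht.not_ge, if_neg ht.not_ge, mul_zero, mul_zero]

lemma integrable_prod_expMeasure_of_abs_le (ha : 0 < a) (hb : 0 < b) {f : ℝ × ℝ → ℝ}
    (hf : Measurable f) {C : ℝ} (hC : ∀ z, |f z| ≤ |z.1| + |z.2| + C) :
    Integrable f ((expMeasure a).prod (expMeasure b)) :=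
  have := isProbabilityMeasure_expMeasure ha
  have := isProbabilityMeasure_expMeasure hb
  .mono' ((((integrable_id_expMeasure ha).comp_fst _).abs.add
      ((integrable_id_expMeasure hb).comp_snd _).abs).add (integrable_const C))
    hf.aestronglyMeasurable (ae_of_all _ hC)

lemma integral_max_prod_expMeasure (ha : 0 < a) (hb : 0 < b) :
    ∫ z, max z.1 z.2 ∂(expMeasure a).prod (expMeasure b) = 1 / a + 1 / b - 1 / (a + b) := by
  have h_law := maxLaw_add_smul ha hb le_rfl
  calc ∫ z, max z.1 z.2 ∂(expMeasure a).prod (expMeasure b) = ∫ x, x ∂maxLaw a b 0 := by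
        rw [maxLaw, integral_map (by fun_prop) (by fun_prop)]
        simp only [sub_zero]
    _ = 1 / a + 1 / b - 1 / (a + b) := by
        rw [integral_of_add_smul_eq h_law (integrable_id_expMeasure (add_pos ha hb))
          (integrable_id_expMeasure hb) (integrable_id_expMeasure ha), integral_id_expMeasure ha,
          integral_id_expMeasure hb, integral_id_expMeasure (add_pos ha hb), mul_zero, neg_zero,
          Real.exp_zero, Real.toNNReal_one, NNReal.coe_one]
        ring

/-- The mean of `f (X, Y)` for independent `X` and `Y` that are exponential with the rates `a` and
`b`. -/
noncomputable def pairMean (f : ℝ × ℝ → ℝ) (a b : ℝ) : ℝ :=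
  ∫ z, f z ∂(expMeasure a).prod (expMeasure b)

lemma integrable_expMeasure_prod_maxLaw {f : ℝ × ℝ → ℝ}
    (hf : ∀ r s, 0 < r → 0 < s → Integrable f ((expMeasure r).prod (expMeasure s)))
    {r : ℝ} (hr : 0 < r) (ha : 0 < a) (hb : 0 < b) (hd : 0 ≤ d) :
    Integrable f ((expMeasure r).prod (maxLaw a b d)) :=
  integrable_of_add_smul_eq (prod_add_smul_eq _ (maxLaw_add_smul ha hb hd)) (hf r b hr hb)
    (hf r a hr ha)

lemma integral_expMeasure_prod_maxLaw {f : ℝ × ℝ → ℝ}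
    (hf : ∀ r s, 0 < r → 0 < s → Integrable f ((expMeasure r).prod (expMeasure s)))
    {r : ℝ} (hr : 0 < r) (ha : 0 < a) (hb : 0 < b) (hd : 0 ≤ d) :
    ∫ z, f z ∂(expMeasure r).prod (maxLaw a b d)
      = pairMean f r b + Real.exp (-(a * d)) * (pairMean f r a - pairMean f r (a + b)) := by
  rw [integral_of_add_smul_eq (prod_add_smul_eq _ (maxLaw_add_smul ha hb hd))
    (hf _ _ hr (add_pos ha hb)) (hf r b hr hb) (hf r a hr ha),
    Real.coe_toNNReal _ (Real.exp_pos _).le]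
  rfl

lemma integrable_maxLaw_prod_maxLaw {f : ℝ × ℝ → ℝ}
    (hf : ∀ r s, 0 < r → 0 < s → Integrable f ((expMeasure r).prod (expMeasure s)))
    (ha : 0 < a) (hb : 0 < b) (ha' : 0 < a') (hb' : 0 < b') (hd : 0 ≤ d) :
    Integrable f ((maxLaw a b d).prod (maxLaw a' b' d)) :=
  integrable_of_add_smul_eq (add_smul_prod_eq _ (maxLaw_add_smul ha hb hd))
    (integrable_expMeasure_prod_maxLaw hf hb ha' hb' hd)
    (integrable_expMeasure_prod_maxLaw hf ha ha' hb' hd)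

lemma integral_maxLaw_prod_maxLaw {f : ℝ × ℝ → ℝ}
    (hf : ∀ r s, 0 < r → 0 < s → Integrable f ((expMeasure r).prod (expMeasure s)))
    (ha : 0 < a) (hb : 0 < b) (ha' : 0 < a') (hb' : 0 < b') (hd : 0 ≤ d) :
    ∫ z, f z ∂(maxLaw a b d).prod (maxLaw a' b' d)
      = pairMean f b b'
        + Real.exp (-(a * d)) * (pairMean f a b' - pairMean f (a + b) b')
        + Real.exp (-(a' * d)) * (pairMean f b a' - pairMean f b (a' + b'))
        + Real.exp (-((a + a') * d)) * (pairMean f a a' - pairMean f a (a' + b')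
          - pairMean f (a + b) a' + pairMean f (a + b) (a' + b')) := by
  rw [integral_of_add_smul_eq (add_smul_prod_eq _ (maxLaw_add_smul ha hb hd))
      (integrable_expMeasure_prod_maxLaw hf (add_pos ha hb) ha' hb' hd)
      (integrable_expMeasure_prod_maxLaw hf hb ha' hb' hd)
      (integrable_expMeasure_prod_maxLaw hf ha ha' hb' hd),
    integral_expMeasure_prod_maxLaw hf (add_pos ha hb) ha' hb' hd,
    integral_expMeasure_prod_maxLaw hf hb ha' hb' hd,
    integral_expMeasure_prod_maxLaw hf ha ha' hb' hd, add_mul a a' d, neg_add, Real.exp_add,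
    Real.coe_toNNReal _ (Real.exp_pos _).le]
  ring

end MaxLaw

section Potential

variable {h : ℝ → ℝ} {C : ℝ}

/-- The larger coordinate, corrected by a function `h` of the distance of the coordinates. -/
def potential (h : ℝ → ℝ) (z : ℝ × ℝ) : ℝ := max z.1 z.2 + h |z.1 - z.2|

lemma measurable_potential (hm : Measurable h) : Measurable (potential h) := by
  unfold potential
  fun_prop

lemma potential_swap (h : ℝ → ℝ) (z : ℝ × ℝ) : potential h z.swap = potential h z := by
  rw [potential, potential, Prod.fst_swap, Prod.snd_swap, max_comm, abs_sub_comm]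

lemma potential_of_le {z : ℝ × ℝ} (hz : z.1 ≤ z.2) :
    potential h z = z.2 + h (z.2 - z.1) := by
  rw [potential, max_eq_right hz, abs_sub_comm, abs_of_nonneg (sub_nonneg.2 hz)]

lemma potential_add_left (h : ℝ → ℝ) (c : ℝ) (z : ℝ × ℝ) :
    potential h (c + z.1, c + z.2) = c + potential h z := by
  rw [potential, potential, max_add_add_left, add_sub_add_left_eq_sub, add_assoc]

lemma abs_potential_le (hC : ∀ r, 0 ≤ r → |h r| ≤ C) (z : ℝ × ℝ) :
    |potential h z| ≤ |z.1| + |z.2| + C :=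
  (abs_add_le _ _).trans <| add_le_add
    (abs_max_le_max_abs_abs.trans (max_le_add_of_nonneg (abs_nonneg _) (abs_nonneg _)))
    (hC _ (abs_nonneg _))

lemma abs_potential_sub_le (hC : ∀ r, 0 ≤ r → |h r| ≤ C) (z z' : ℝ × ℝ) :
    |potential h z - potential h z'| ≤ |max z.1 z.2 - max z'.1 z'.2| + 2 * C := by
  have hz := abs_le.1 (hC |z.1 - z.2| (abs_nonneg _))
  have hz' := abs_le.1 (hC |z'.1 - z'.2| (abs_nonneg _))
  calc |potential h z - potential h z'|
      = |max z.1 z.2 - max z'.1 z'.2 + (h |z.1 - z.2| - h |z'.1 - z'.2|)| := by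
        rw [potential, potential, add_sub_add_comm]
    _ ≤ |max z.1 z.2 - max z'.1 z'.2| + |(h |z.1 - z.2| - h |z'.1 - z'.2|)| := abs_add_le _ _
    _ ≤ |max z.1 z.2 - max z'.1 z'.2| + 2 * C := by
        gcongr
        exact abs_le.2 ⟨by linarith, by linarith⟩

lemma integrable_potential (hm : Measurable h) (hC : ∀ r, 0 ≤ r → |h r| ≤ C) (a b : ℝ)
    (ha : 0 < a) (hb : 0 < b) : Integrable (potential h) ((expMeasure a).prod (expMeasure b)) :=
  integrable_prod_expMeasure_of_abs_le ha hb (measurable_potential hm) (abs_potential_le hC)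

lemma pairMean_potential (hm : Measurable h) (hC : ∀ r, 0 ≤ r → |h r| ≤ C) {a b : ℝ}
    (ha : 0 < a) (hb : 0 < b) :
    pairMean (potential h) a b = 1 / a + 1 / b - 1 / (a + b)
      + (b * ∫ x, h x ∂expMeasure a + a * ∫ x, h x ∂expMeasure b) / (a + b) := by
  have := isProbabilityMeasure_expMeasure ha
  have := isProbabilityMeasure_expMeasure hb
  have h_max : Integrable (fun z : ℝ × ℝ => max z.1 z.2) ((expMeasure a).prod (expMeasure b)) :=
    ((integrable_id_expMeasure ha).comp_fst _).sup ((integrable_id_expMeasure hb).comp_snd _)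
  have h_dist : Integrable (fun z : ℝ × ℝ => h |z.1 - z.2|)
      ((expMeasure a).prod (expMeasure b)) :=
    .mono' (integrable_const C) (Measurable.aestronglyMeasurable (by fun_prop))
      (ae_of_all _ fun _ => hC _ (abs_nonneg _))
  calc pairMean (potential h) a b
      = ∫ z, max z.1 z.2 ∂(expMeasure a).prod (expMeasure b)
        + ∫ z, h |z.1 - z.2| ∂(expMeasure a).prod (expMeasure b) := integral_add h_max h_dist
    _ = _ := by
        rw [integral_max_prod_expMeasure ha hb, integral_comp_abs_sub_prod_expMeasure ha hb
          (integrable_expMeasure_of_abs_le ha hm hC) (integrable_expMeasure_of_abs_le hb hm hC)]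

end Potential

section Step

variable {μ ν σ τ : ℝ}

/-- The max-plus product of the matrix with rows `w.1`, `w.2` and the vector `z`. -/
def step (z : ℝ × ℝ) (w : (ℝ × ℝ) × (ℝ × ℝ)) : ℝ × ℝ :=
  (max (z.1 + w.1.1) (z.2 + w.1.2), max (z.1 + w.2.1) (z.2 + w.2.2))

/-- The law of a matrix with independent exponential entries, with the rates `μ, ν` in the first
row and `σ, τ` in the second. -/
noncomputable def matrixLaw (μ ν σ τ : ℝ) : Measure ((ℝ × ℝ) × (ℝ × ℝ)) :=
  ((expMeasure μ).prod (expMeasure ν)).prod ((expMeasure σ).prod (expMeasure τ))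

lemma measurable_step : Measurable (Function.uncurry step) := by
  unfold Function.uncurry step
  fun_prop

lemma step_eq_sub_add (z : ℝ × ℝ) (w : (ℝ × ℝ) × (ℝ × ℝ)) :
    step z w = (z.2 + max (w.1.1 - (z.2 - z.1)) w.1.2, z.2 + max (w.2.1 - (z.2 - z.1)) w.2.2) := by
  simp only [step, ← max_add_add_left]
  ring_nf

lemma abs_max_step_sub_max_le (z : ℝ × ℝ) (w : (ℝ × ℝ) × (ℝ × ℝ)) :
    |max (step z w).1 (step z w).2 - max z.1 z.2| ≤ |w.1.1| + |w.1.2| + (|w.2.1| + |w.2.2|) := by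
  have h_max : max (step z w).1 (step z w).2
      = max (z.1 + max w.1.1 w.2.1) (z.2 + max w.1.2 w.2.2) := by
    simp only [step, max_max_max_comm, max_add_add_left]
  have h_fst : |max w.1.1 w.2.1| ≤ |w.1.1| + |w.2.1| :=
    abs_max_le_max_abs_abs.trans (max_le_add_of_nonneg (abs_nonneg _) (abs_nonneg _))
  have h_snd : |max w.1.2 w.2.2| ≤ |w.1.2| + |w.2.2| :=
    abs_max_le_max_abs_abs.trans (max_le_add_of_nonneg (abs_nonneg _) (abs_nonneg _))
  calc |max (step z w).1 (step z w).2 - max z.1 z.2|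
      ≤ max |z.1 + max w.1.1 w.2.1 - z.1| |z.2 + max w.1.2 w.2.2 - z.2| := by
        rw [h_max]
        exact abs_max_sub_max_le_max _ _ _ _
    _ ≤ |max w.1.1 w.2.1| + |max w.1.2 w.2.2| := by
        rw [add_sub_cancel_left, add_sub_cancel_left]
        exact max_le_add_of_nonneg (abs_nonneg _) (abs_nonneg _)
    _ ≤ |w.1.1| + |w.1.2| + (|w.2.1| + |w.2.2|) := by linarith

lemma isProbabilityMeasure_matrixLaw (hμ : 0 < μ) (hν : 0 < ν) (hσ : 0 < σ) (hτ : 0 < τ) :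
    IsProbabilityMeasure (matrixLaw μ ν σ τ) := by
  have := isProbabilityMeasure_expMeasure hμ
  have := isProbabilityMeasure_expMeasure hν
  have := isProbabilityMeasure_expMeasure hσ
  have := isProbabilityMeasure_expMeasure hτ
  unfold matrixLaw
  infer_instance

lemma memLp_sum_abs_matrixLaw (hμ : 0 < μ) (hν : 0 < ν) (hσ : 0 < σ) (hτ : 0 < τ) :
    MemLp (fun w : (ℝ × ℝ) × (ℝ × ℝ) => |w.1.1| + |w.1.2| + (|w.2.1| + |w.2.2|)) 2
      (matrixLaw μ ν σ τ) := by
  have := isProbabilityMeasure_expMeasure hμ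
  have := isProbabilityMeasure_expMeasure hν
  have := isProbabilityMeasure_expMeasure hσ
  have := isProbabilityMeasure_expMeasure hτ
  have h_row {a b : ℝ} (ha : 0 < a) (hb : 0 < b) [IsFiniteMeasure (expMeasure a)]
      [IsFiniteMeasure (expMeasure b)] :
      MemLp (fun z : ℝ × ℝ => |z.1| + |z.2|) 2 ((expMeasure a).prod (expMeasure b)) :=
    ((memLp_id_expMeasure ha).abs.comp_fst _).add ((memLp_id_expMeasure hb).abs.comp_snd _)
  exact ((h_row hμ hν).comp_fst _).add ((h_row hσ hτ).comp_snd _)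

lemma map_step_matrixLaw (μ ν σ τ : ℝ) (z : ℝ × ℝ) :
    (matrixLaw μ ν σ τ).map (step z)
      = ((maxLaw μ ν (z.2 - z.1)).prod (maxLaw σ τ (z.2 - z.1))).map
        fun v => (z.2 + v.1, z.2 + v.2) := by
  rw [maxLaw, maxLaw, Measure.map_prod_map _ _ (by fun_prop) (by fun_prop),
    Measure.map_map (by fun_prop) (by fun_prop)]
  exact congrArg (Measure.map · _) (funext (step_eq_sub_add z))

lemma integral_potential_step {h : ℝ → ℝ} (hm : Measurable h) {C : ℝ}
    (hC : ∀ r, 0 ≤ r → |h r| ≤ C) (hμ : 0 < μ) (hν : 0 < ν) (hσ : 0 < σ) (hτ : 0 < τ)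
    {z : ℝ × ℝ} (hz : z.1 ≤ z.2) :
    ∫ w, potential h (step z w) ∂matrixLaw μ ν σ τ
      = z.2 + ∫ v, potential h v ∂(maxLaw μ ν (z.2 - z.1)).prod (maxLaw σ τ (z.2 - z.1)) := by
  have := isProbabilityMeasure_maxLaw hμ hν (z.2 - z.1)
  have := isProbabilityMeasure_maxLaw hσ hτ (z.2 - z.1)
  have h_meas := (measurable_potential hm).stronglyMeasurable
  rw [← integral_map (measurable_step.of_uncurry_left (x := z)).aemeasurable
      h_meas.aestronglyMeasurable, map_step_matrixLaw,
    integral_map (by fun_prop) h_meas.aestronglyMeasurable]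
  simp only [potential_add_left]
  rw [integral_add (integrable_const _) (integrable_maxLaw_prod_maxLaw
    (integrable_potential hm hC) hμ hν hσ hτ (sub_nonneg.2 hz)), integral_const, probReal_univ,
    one_smul]

lemma measurePreserving_reverse_matrixLaw (μ ν σ τ : ℝ) :
    MeasurePreserving (fun w : (ℝ × ℝ) × (ℝ × ℝ) => (w.2.swap, w.1.swap))
      (matrixLaw μ ν σ τ) (matrixLaw τ σ ν μ) :=
  (Measure.measurePreserving_swap.prod Measure.measurePreserving_swap).comp
    Measure.measurePreserving_swap

lemma step_swap_reverse (z : ℝ × ℝ) (w : (ℝ × ℝ) × (ℝ × ℝ)) :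
    step z.swap (w.2.swap, w.1.swap) = (step z w).swap :=
  Prod.ext (max_comm _ _) (max_comm _ _)

lemma integral_potential_step_swap {h : ℝ → ℝ} (hm : Measurable h) (μ ν σ τ : ℝ) (z : ℝ × ℝ) :
    ∫ w, potential h (step z.swap w) ∂matrixLaw τ σ ν μ
      = ∫ w, potential h (step z w) ∂matrixLaw μ ν σ τ := by
  have h_reverse := measurePreserving_reverse_matrixLaw μ ν σ τ
  have h_meas : Measurable fun w => potential h (step z.swap w) :=
    (measurable_potential hm).comp measurable_step.of_uncurry_left
  rw [← h_reverse.map_eq, integral_map h_reverse.aemeasurable h_meas.aestronglyMeasurable]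
  simp only [step_swap_reverse, potential_swap]

end Step

section Corrector

variable {μ ν : ℝ}

/-- The numerator over `denQ μ ν` of the coefficient of `exp (-(μ * r))` in the corrector. The
coefficients of the corrector solve the linear system that equates the coefficients of the
exponentials on both sides of the Poisson equation. -/
def corrNum (μ ν : ℝ) : ℝ :=
  64 * ν ^ 10 + 672 * μ * ν ^ 9 + 2872 * μ ^ 2 * ν ^ 8 + 6572 * μ ^ 3 * ν ^ 7
    + 8786 * μ ^ 4 * ν ^ 6 + 6944 * μ ^ 5 * ν ^ 5 + 3118 * μ ^ 6 * ν ^ 4 + 716 * μ ^ 7 * ν ^ 3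
    + 64 * μ ^ 8 * ν ^ 2

/-- The numerator over `denQ μ ν` of the coefficient of `exp (-((μ + ν) * r))` in the corrector. -/
def corrNumSum (μ ν : ℝ) : ℝ :=
  -(32 * μ ^ 2 * ν ^ 8 + 348 * μ ^ 3 * ν ^ 7 + 1254 * μ ^ 4 * ν ^ 6 + 1916 * μ ^ 5 * ν ^ 5
    + 1254 * μ ^ 6 * ν ^ 4 + 348 * μ ^ 7 * ν ^ 3 + 32 * μ ^ 8 * ν ^ 2)

/-- The bounded function of the distance of the coordinates which, added to the larger coordinate,
solves the Poisson equation of the system with the rates `μ, ν, ν, μ`. -/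
noncomputable def corrector (μ ν r : ℝ) : ℝ :=
  corrNum μ ν / denQ μ ν * Real.exp (-(μ * r)) + corrNum ν μ / denQ μ ν * Real.exp (-(ν * r))
    + corrNumSum μ ν / denQ μ ν * Real.exp (-((μ + ν) * r))

lemma denQ_pos (hμ : 0 < μ) (hν : 0 < ν) : 0 < denQ μ ν := by
  unfold denQ
  positivity

lemma measurable_corrector (μ ν : ℝ) : Measurable (corrector μ ν) := by
  unfold corrector
  fun_prop

lemma exists_abs_corrector_le (hμ : 0 ≤ μ) (hν : 0 ≤ ν) :
    ∃ C, ∀ r, 0 ≤ r → |corrector μ ν r| ≤ C := by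
  have h_term (q : ℝ) {c r : ℝ} (hc : 0 ≤ c) (hr : 0 ≤ r) :
      |q * Real.exp (-(c * r))| ≤ |q| := by
    rw [abs_mul]
    exact mul_le_of_le_one_right (abs_nonneg _) (abs_exp_neg_mul_le_one hc hr)
  exact ⟨_, fun r hr => (abs_add_three _ _ _).trans <| add_le_add_three (h_term _ hμ hr)
    (h_term _ hν hr) (h_term _ (add_nonneg hμ hν) hr)⟩

lemma integral_corrector {a : ℝ} (hμ : 0 < μ) (hν : 0 < ν) (ha : 0 < a) :
    ∫ x, corrector μ ν x ∂expMeasure a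
      = corrNum μ ν / denQ μ ν * (a / (a + μ)) + corrNum ν μ / denQ μ ν * (a / (a + ν))
        + corrNumSum μ ν / denQ μ ν * (a / (a + (μ + ν))) := by
  have h_term (q : ℝ) {c : ℝ} (hc : 0 < c) :
      Integrable (fun x => q * Real.exp (-(c * x))) (expMeasure a) :=
    (integrable_exp_neg_expMeasure ha hc.le).const_mul q
  unfold corrector
  rw [integral_add ((h_term _ hμ).fun_add (h_term _ hν)) (h_term _ (add_pos hμ hν)),
    integral_add (h_term _ hμ) (h_term _ hν), integral_const_mul, integral_const_mul,
    integral_const_mul, integral_exp_neg_expMeasure ha hμ.le,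
    integral_exp_neg_expMeasure ha hν.le, integral_exp_neg_expMeasure ha (add_pos hμ hν).le]

lemma pairMean_corrector {a b : ℝ} (hμ : 0 < μ) (hν : 0 < ν) (ha : 0 < a) (hb : 0 < b) :
    pairMean (potential (corrector μ ν)) a b = 1 / a + 1 / b - 1 / (a + b)
      + (b * (corrNum μ ν / denQ μ ν * (a / (a + μ)) + corrNum ν μ / denQ μ ν * (a / (a + ν))
          + corrNumSum μ ν / denQ μ ν * (a / (a + (μ + ν))))
        + a * (corrNum μ ν / denQ μ ν * (b / (b + μ)) + corrNum ν μ / denQ μ ν * (b / (b + ν))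
          + corrNumSum μ ν / denQ μ ν * (b / (b + (μ + ν))))) / (a + b) := by
  obtain ⟨C, hC⟩ := exists_abs_corrector_le hμ.le hν.le
  rw [pairMean_potential (measurable_corrector μ ν) hC ha hb, integral_corrector hμ hν ha,
    integral_corrector hμ hν hb]

lemma pairMean_corrector_rates (hμ : 0 < μ) (hν : 0 < ν) :
    pairMean (potential (corrector μ ν)) ν μ = numP μ ν / denQ μ ν := by
  have hQ := (denQ_pos hμ hν).ne'
  rw [pairMean_corrector hμ hν hν hμ, eq_div_iff hQ]
  field_simp
  unfold corrNum corrNumSum denQ numP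
  ring

lemma pairMean_corrector_coeff_fst (hμ : 0 < μ) (hν : 0 < ν) :
    pairMean (potential (corrector μ ν)) μ μ - pairMean (potential (corrector μ ν)) (μ + ν) μ
      = corrNum μ ν / denQ μ ν := by
  have hQ := (denQ_pos hμ hν).ne'
  rw [pairMean_corrector hμ hν hμ hμ, pairMean_corrector hμ hν (add_pos hμ hν) hμ, eq_div_iff hQ]
  field_simp
  unfold corrNum corrNumSum denQ
  ring

lemma pairMean_corrector_coeff_snd (hμ : 0 < μ) (hν : 0 < ν) :
    pairMean (potential (corrector μ ν)) ν ν - pairMean (potential (corrector μ ν)) ν (ν + μ)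
      = corrNum ν μ / denQ μ ν := by
  have hQ := (denQ_pos hμ hν).ne'
  rw [pairMean_corrector hμ hν hν hν, pairMean_corrector hμ hν hν (add_pos hν hμ), eq_div_iff hQ]
  field_simp
  unfold corrNum corrNumSum denQ
  ring

lemma pairMean_corrector_coeff_sum (hμ : 0 < μ) (hν : 0 < ν) :
    pairMean (potential (corrector μ ν)) μ ν - pairMean (potential (corrector μ ν)) μ (ν + μ)
        - pairMean (potential (corrector μ ν)) (μ + ν) ν
        + pairMean (potential (corrector μ ν)) (μ + ν) (ν + μ)
      = corrNumSum μ ν / denQ μ ν := by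
  have hQ := (denQ_pos hμ hν).ne'
  have hμν := add_pos hμ hν
  rw [add_comm ν μ, pairMean_corrector hμ hν hμ hν, pairMean_corrector hμ hν hμ hμν,
    pairMean_corrector hμ hν hμν hν, pairMean_corrector hμ hν hμν hμν, eq_div_iff hQ]
  field_simp
  unfold corrNum corrNumSum denQ
  ring

lemma integral_potential_corrector_step (hμ : 0 < μ) (hν : 0 < ν) (z : ℝ × ℝ) :
    ∫ w, potential (corrector μ ν) (step z w) ∂matrixLaw μ ν ν μ
      = potential (corrector μ ν) z + numP μ ν / denQ μ ν := by
  have h_meas := measurable_corrector μ ν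
  obtain ⟨C, hC⟩ := exists_abs_corrector_le hμ.le hν.le
  wlog hz : z.1 ≤ z.2 generalizing z
  · rw [← integral_potential_step_swap h_meas, this z.swap (le_of_not_ge hz), potential_swap]
  rw [integral_potential_step h_meas hC hμ hν hν hμ hz, potential_of_le hz, corrector,
    integral_maxLaw_prod_maxLaw (integrable_potential h_meas hC) hμ hν hν hμ (sub_nonneg.2 hz),
    pairMean_corrector_rates hμ hν, pairMean_corrector_coeff_fst hμ hν,
    pairMean_corrector_coeff_snd hμ hν, pairMean_corrector_coeff_sum hμ hν]
  ring

end Corrector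

section OrthogonalIncrements

variable {Ω : Type*} [MeasurableSpace Ω] {P : Measure Ω}

lemma ae_tendsto_zero_of_summable_integral {f : ℕ → Ω → ℝ} (hf : ∀ n, Integrable (f n) P)
    (h_nonneg : ∀ n ω, 0 ≤ f n ω) (h_sum : Summable fun n => ∫ ω, f n ω ∂P) :
    ∀ᵐ ω ∂P, Tendsto (fun n => f n ω) atTop (𝓝 0) := by
  have h_meas (n : ℕ) : AEMeasurable (fun ω => ENNReal.ofReal (f n ω)) P :=
    (hf n).aestronglyMeasurable.aemeasurable.ennreal_ofReal
  have h_fin : ∫⁻ ω, ∑' n, ENNReal.ofReal (f n ω) ∂P ≠ ⊤ := by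
    rw [lintegral_tsum h_meas]
    simp only [← ofReal_integral_eq_lintegral_ofReal (hf _) (ae_of_all _ (h_nonneg _))]
    exact h_sum.tsum_ofReal_ne_top
  filter_upwards [ae_lt_top' (AEMeasurable.tsum h_meas) h_fin] with ω hω
  have h_lim := (ENNReal.tendsto_toReal ENNReal.zero_ne_top).comp
    (ENNReal.tendsto_atTop_zero_of_tsum_ne_top hω.ne)
  exact h_lim.congr fun n => ENNReal.toReal_ofReal (h_nonneg n ω)

lemma ae_tendsto_div_sq {M : ℕ → Ω → ℝ} (hM : ∀ n, MemLp (M n) 2 P) {A K : ℝ}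
    (h_growth : ∀ n : ℕ, ∫ ω, M n ω ^ 2 ∂P ≤ A + n * K) :
    ∀ᵐ ω ∂P, Tendsto (fun n : ℕ => M (n ^ 2) ω / (n : ℝ) ^ 2) atTop (𝓝 0) := by
  have h_le (n : ℕ) : ∫ ω, (M (n ^ 2) ω / (n : ℝ) ^ 2) ^ 2 ∂P
      ≤ A * (1 / (n : ℝ) ^ 4) + K * (1 / (n : ℝ) ^ 2) := by
    rcases Nat.eq_zero_or_pos n with rfl | hn
    · simp
    · simp only [div_pow]
      rw [integral_div, div_le_iff₀ (by positivity)]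
      refine (h_growth (n ^ 2)).trans_eq ?_
      push_cast
      field_simp
  have h_sum : Summable fun n : ℕ => A * (1 / (n : ℝ) ^ 4) + K * (1 / (n : ℝ) ^ 2) :=
    ((Real.summable_one_div_nat_pow.2 (by norm_num)).mul_left A).add
      ((Real.summable_one_div_nat_pow.2 one_lt_two).mul_left K)
  have h_int (n : ℕ) : Integrable (fun ω => (M (n ^ 2) ω / (n : ℝ) ^ 2) ^ 2) P := by
    simp only [div_pow]
    exact (hM _).integrable_sq.div_const _
  filter_upwards [ae_tendsto_zero_of_summable_integral h_int (fun _ _ => sq_nonneg _)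
    (h_sum.of_nonneg_of_le (fun _ => integral_nonneg fun _ => sq_nonneg _) h_le)] with ω hω
  refine (tendsto_zero_iff_abs_tendsto_zero _).2 ?_
  simpa only [Function.comp_def, Real.sqrt_sq_eq_abs, Real.sqrt_zero] using hω.sqrt

lemma integral_sq_le_of_orthogonal_increments {M : ℕ → Ω → ℝ} (hM : ∀ n, MemLp (M n) 2 P)
    (h_orth : ∀ n, ∫ ω, M n ω * (M (n + 1) ω - M n ω) ∂P = 0) {K : ℝ}
    (hK : ∀ n, ∫ ω, (M (n + 1) ω - M n ω) ^ 2 ∂P ≤ K) (n : ℕ) :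
    ∫ ω, M n ω ^ 2 ∂P ≤ ∫ ω, M 0 ω ^ 2 ∂P + n * K := by
  induction n with
  | zero => simp
  | succ n ih =>
    have h_incr : MemLp (fun ω => M (n + 1) ω - M n ω) 2 P := (hM (n + 1)).sub (hM n)
    have h_cross : Integrable (fun ω => 2 * (M n ω * (M (n + 1) ω - M n ω))) P :=
      ((hM n).integrable_mul h_incr).const_mul 2
    calc ∫ ω, M (n + 1) ω ^ 2 ∂P
        = ∫ ω, (M n ω ^ 2 + 2 * (M n ω * (M (n + 1) ω - M n ω))
            + (M (n + 1) ω - M n ω) ^ 2) ∂P := by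
          congr 1 with ω
          ring
      _ = ∫ ω, M n ω ^ 2 ∂P + ∫ ω, (M (n + 1) ω - M n ω) ^ 2 ∂P := by
          rw [integral_add ((hM n).integrable_sq.fun_add h_cross) h_incr.integrable_sq,
            integral_add (hM n).integrable_sq h_cross, integral_const_mul, h_orth, mul_zero,
            add_zero]
      _ ≤ ∫ ω, M 0 ω ^ 2 ∂P + (n + 1 : ℕ) * K := by
          push_cast
          linarith [hK n]

lemma tendsto_div_of_monotone_of_tendsto_div_sq {u : ℕ → ℝ} {l : ℝ} (hu : Monotone u)
    (h_lim : Tendsto (fun n : ℕ => u (n ^ 2) / (n : ℝ) ^ 2) atTop (𝓝 l)) :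
    Tendsto (fun k : ℕ => u k / k) atTop (𝓝 l) := by
  refine tendsto_div_of_monotone_of_exists_subseq_tendsto_div u l hu fun a ha =>
    ⟨fun n => n ^ 2, ?_, tendsto_pow_atTop two_ne_zero, by simpa only [Nat.cast_pow] using h_lim⟩
  have h_ratio : Tendsto (fun n : ℕ => (1 + 1 / (n : ℝ)) ^ 2) atTop (𝓝 1) := by
    simpa using ((tendsto_one_div_atTop_nhds_zero_nat (𝕜 := ℝ)).const_add 1).pow 2
  filter_upwards [h_ratio.eventually_lt_const ha, eventually_gt_atTop 0] with n hn h_pos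
  push_cast
  calc ((n : ℝ) + 1) ^ 2 = (1 + 1 / (n : ℝ)) ^ 2 * (n : ℝ) ^ 2 := by field_simp
    _ ≤ a * (n : ℝ) ^ 2 := by gcongr

end OrthogonalIncrements

section RandomRecursion

variable {Ω S E : Type*} [MeasurableSpace Ω] [MeasurableSpace S] [MeasurableSpace E]
  {P : Measure Ω} {m : Measure E} {Φ : S → E → S} {Z : ℕ → Ω → S} {W : ℕ → Ω → E}
  {f : S → ℝ} {l : ℝ}

/-- The process `Z` is driven by the recursion `Z (n + 1) = Φ (Z n) (W n)`, in which the input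
`W n` has law `m` and is independent of `Z n`. -/
structure IsRandomRecursion (Φ : S → E → S) (m : Measure E) (P : Measure Ω) (Z : ℕ → Ω → S)
    (W : ℕ → Ω → E) : Prop where
  succ : ∀ n ω, Z (n + 1) ω = Φ (Z n ω) (W n ω)
  aemeasurable : ∀ n, AEMeasurable (Z n) P
  hasLaw : ∀ n, HasLaw (W n) m P
  indepFun : ∀ n, IndepFun (Z n) (W n) P

/-- The function `f` solves the Poisson equation with constant `l` for the recursion with the step
`Φ` and inputs of law `m`: in one step `f` grows by `l` on average. Its increments are required to
have a common square-integrable bound. -/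
structure SolvesPoisson (Φ : S → E → S) (m : Measure E) (f : S → ℝ) (l : ℝ) : Prop where
  measurable : Measurable f
  exists_abs_sub_le : ∃ g, MemLp g 2 m ∧ ∀ z w, |f (Φ z w) - f z| ≤ g w
  integral_eq : ∀ z, ∫ w, f (Φ z w) ∂m = f z + l

lemma integral_mul_eq_zero_of_indepFun [IsFiniteMeasure P] [SFinite m] {Y : Ω → S} {X : Ω → E}
    (h_indep : IndepFun Y X P) (hY : AEMeasurable Y P) (hX : HasLaw X m P) {u : S → ℝ}
    (hu : Measurable u) {ξ : S × E → ℝ} (hξ : Measurable ξ) (h_zero : ∀ z, ∫ w, ξ (z, w) ∂m = 0)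
    (h_int : Integrable (fun ω => u (Y ω) * ξ (Y ω, X ω)) P) :
    ∫ ω, u (Y ω) * ξ (Y ω, X ω) ∂P = 0 := by
  have h_law : HasLaw (fun ω => (Y ω, X ω)) ((P.map Y).prod m) P :=
    h_indep.hasLaw_prod ⟨hY, rfl⟩ hX
  have h_meas : AEStronglyMeasurable (fun p : S × E => u p.1 * ξ p) ((P.map Y).prod m) :=
    ((hu.comp measurable_fst).mul hξ).aestronglyMeasurable
  have h_int' : Integrable (fun p : S × E => u p.1 * ξ p) ((P.map Y).prod m) := by
    rw [← h_law.map_eq] at h_meas ⊢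
    exact (integrable_map_measure h_meas h_law.aemeasurable).2 h_int
  refine (h_law.integral_comp h_meas).trans ?_
  rw [integral_prod _ h_int']
  simp only [integral_const_mul, h_zero, mul_zero, integral_zero]

namespace SolvesPoisson

lemma integral_increment_eq_zero [IsProbabilityMeasure m] (hf : SolvesPoisson Φ m f l)
    (hΦ : Measurable (Function.uncurry Φ)) (z : S) : ∫ w, (f (Φ z w) - f z - l) ∂m = 0 := by
  obtain ⟨g, hg, h_le⟩ := hf.exists_abs_sub_le
  have h_meas : Measurable fun w => f (Φ z w) := hf.measurable.comp hΦ.of_uncurry_left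
  have h_sub : Integrable (fun w => f (Φ z w) - f z) m :=
    (hg.integrable one_le_two).mono' (h_meas.sub_const _).aestronglyMeasurable
      (ae_of_all _ (h_le z))
  have h_int : Integrable (fun w => f (Φ z w)) m := by
    simpa only [sub_add_cancel] using h_sub.fun_add (integrable_const (f z))
  rw [integral_sub h_sub (integrable_const l), integral_sub h_int (integrable_const _),
    hf.integral_eq, integral_const, integral_const, probReal_univ, one_smul, one_smul]
  ring

lemma exists_integral_increment_sq_le [IsFiniteMeasure m] (hf : SolvesPoisson Φ m f l)
    (hΦ : Measurable (Function.uncurry Φ)) (hZ : IsRandomRecursion Φ m P Z W) :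
    ∃ K, ∀ n, MemLp (fun ω => f (Φ (Z n ω) (W n ω)) - f (Z n ω) - l) 2 P
      ∧ ∫ ω, (f (Φ (Z n ω) (W n ω)) - f (Z n ω) - l) ^ 2 ∂P ≤ K := by
  obtain ⟨g, hg, h_le⟩ := hf.exists_abs_sub_le
  have h_bound : MemLp (fun w => g w + |l|) 2 m := hg.add (memLp_const _)
  refine ⟨∫ w, (g w + |l|) ^ 2 ∂m, fun n => ?_⟩
  have h_le' (ω : Ω) : |f (Φ (Z n ω) (W n ω)) - f (Z n ω) - l| ≤ g (W n ω) + |l| :=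
    (abs_sub _ _).trans (add_le_add_left (h_le _ _) _)
  have h_bound' : MemLp (fun ω => g (W n ω) + |l|) 2 P := by
    rw [← (hZ.hasLaw n).map_eq] at h_bound
    exact h_bound.comp_of_map (hZ.hasLaw n).aemeasurable
  have h_meas : AEMeasurable (fun ω => f (Φ (Z n ω) (W n ω)) - f (Z n ω) - l) P :=
    ((hf.measurable.comp_aemeasurable (hΦ.comp_aemeasurable
      ((hZ.aemeasurable n).prodMk (hZ.hasLaw n).aemeasurable))).sub
      (hf.measurable.comp_aemeasurable (hZ.aemeasurable n))).sub_const l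
  have h_memLp := h_bound'.mono' h_meas.aestronglyMeasurable (ae_of_all _ h_le')
  refine ⟨h_memLp, ?_⟩
  calc ∫ ω, (f (Φ (Z n ω) (W n ω)) - f (Z n ω) - l) ^ 2 ∂P
      ≤ ∫ ω, (g (W n ω) + |l|) ^ 2 ∂P :=
        integral_mono h_memLp.integrable_sq h_bound'.integrable_sq fun ω =>
          sq_le_sq' (abs_le.1 (h_le' ω)).1 (abs_le.1 (h_le' ω)).2
    _ = ∫ w, (g w + |l|) ^ 2 ∂m :=
        (hZ.hasLaw n).integral_comp h_bound.integrable_sq.aestronglyMeasurable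

/- The process `f (Z n) - n * l` is a martingale, so its increments are orthogonal to its values. -/
theorem ae_tendsto_sq_div [IsFiniteMeasure P] [IsProbabilityMeasure m]
    (hf : SolvesPoisson Φ m f l) (hΦ : Measurable (Function.uncurry Φ))
    (hZ : IsRandomRecursion Φ m P Z W) (h_init : MemLp (fun ω => f (Z 0 ω)) 2 P) :
    ∀ᵐ ω ∂P, Tendsto (fun n : ℕ => f (Z (n ^ 2) ω) / (n : ℝ) ^ 2) atTop (𝓝 l) := by
  obtain ⟨K, h_incr⟩ := hf.exists_integral_increment_sq_le hΦ hZ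
  set M : ℕ → Ω → ℝ := fun n ω => f (Z n ω) - n * l with hM
  have h_sub (n : ℕ) (ω : Ω) : M (n + 1) ω - M n ω = f (Φ (Z n ω) (W n ω)) - f (Z n ω) - l := by
    simp only [hM, hZ.succ]
    push_cast
    ring
  have h_memLp (n : ℕ) : MemLp (M n) 2 P := by
    induction n with
    | zero => simpa [hM] using h_init
    | succ n ih =>
      have h_succ : M (n + 1) = fun ω => M n ω + (f (Φ (Z n ω) (W n ω)) - f (Z n ω) - l) :=
        funext fun ω => by rw [← h_sub, add_sub_cancel]
      exact h_succ ▸ ih.add (h_incr n).1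
  have h_orth (n : ℕ) : ∫ ω, M n ω * (M (n + 1) ω - M n ω) ∂P = 0 := by
    have h_int := (h_memLp n).integrable_mul (h_incr n).1
    simp only [h_sub]
    exact integral_mul_eq_zero_of_indepFun (hZ.indepFun n) (hZ.aemeasurable n) (hZ.hasLaw n)
      (hf.measurable.sub_const _) (ξ := fun p => f (Φ p.1 p.2) - f p.1 - l)
      (((hf.measurable.comp hΦ).sub (hf.measurable.comp measurable_fst)).sub_const l)
      (hf.integral_increment_eq_zero hΦ) h_int
  have h_growth := integral_sq_le_of_orthogonal_increments h_memLp h_orth (K := K) fun n => by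
    simpa only [h_sub] using (h_incr n).2
  filter_upwards [ae_tendsto_div_sq h_memLp h_growth] with ω hω
  have h_lim := hω.add_const l
  rw [zero_add] at h_lim
  refine h_lim.congr' ?_
  filter_upwards [eventually_gt_atTop 0] with n hn
  simp only [hM]
  push_cast
  field_simp
  ring

end SolvesPoisson

end RandomRecursion

section ExponentialSystem

variable {Ω : Type*} {μ ν σ τ : ℝ} {α β γ δ : ℕ → Ω → ℝ}

/-- The matrix `A (n + 1)` of the system, as the pair of its rows. -/
def matrixAt (α β γ δ : ℕ → Ω → ℝ) (n : ℕ) (ω : Ω) : (ℝ × ℝ) × (ℝ × ℝ) :=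
  ((α n ω, β n ω), (γ n ω, δ n ω))

lemma exists_measurable_state_eq (α β γ δ : ℕ → Ω → ℝ) (n : ℕ) :
    ∃ F : (↥((Finset.univ : Finset (Fin 4)) ×ˢ Finset.range n) → ℝ) → ℝ × ℝ,
      Measurable F ∧ ∀ ω, state α β γ δ n ω = F fun i => (![α, β, γ, δ] i.1.1) i.1.2 ω := by
  induction n with
  | zero => exact ⟨fun _ => (0, 0), measurable_const, fun _ => rfl⟩
  | succ n ih =>
    obtain ⟨F, hF, h_eq⟩ := ih
    have h_subset : (Finset.univ : Finset (Fin 4)) ×ˢ Finset.range n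
        ⊆ Finset.univ ×ˢ Finset.range (n + 1) :=
      Finset.product_subset_product_right (Finset.range_subset_range.2 n.le_succ)
    have h_mem (i : Fin 4) : (i, n) ∈ (Finset.univ : Finset (Fin 4)) ×ˢ Finset.range (n + 1) := by
      simp
    refine ⟨fun v => step (F (Finset.restrict₂ (π := fun _ => ℝ) h_subset v))
      ((v ⟨(0, n), h_mem 0⟩, v ⟨(1, n), h_mem 1⟩), (v ⟨(2, n), h_mem 2⟩, v ⟨(3, n), h_mem 3⟩)),
      measurable_step.comp ((hF.comp (Finset.measurable_restrict₂ h_subset)).prodMk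
        (by fun_prop)), fun ω => ?_⟩
    change step (state α β γ δ n ω) (matrixAt α β γ δ n ω) = _
    rw [h_eq]
    rfl

lemma solvesPoisson_potential {h : ℝ → ℝ} (hm : Measurable h) {C : ℝ}
    (hC : ∀ r, 0 ≤ r → |h r| ≤ C) (hμ : 0 < μ) (hν : 0 < ν) (hσ : 0 < σ) (hτ : 0 < τ) {l : ℝ}
    (hl : ∀ z, ∫ w, potential h (step z w) ∂matrixLaw μ ν σ τ = potential h z + l) :
    SolvesPoisson step (matrixLaw μ ν σ τ) (potential h) l where
  measurable := measurable_potential hm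
  exists_abs_sub_le :=
    have := isProbabilityMeasure_matrixLaw hμ hν hσ hτ
    ⟨_, (memLp_sum_abs_matrixLaw hμ hν hσ hτ).add (memLp_const (2 * C)), fun z w =>
      (abs_potential_sub_le hC _ _).trans (add_le_add_left (abs_max_step_sub_max_le z w) _)⟩
  integral_eq := hl

variable [MeasurableSpace Ω] {P : Measure Ω}

namespace IsExponentialSystem

lemma aemeasurable_entry (hsys : IsExponentialSystem P μ ν σ τ α β γ δ) (i : Fin 4 × ℕ) :
    AEMeasurable ((![α, β, γ, δ] i.1) i.2) P := by
  obtain ⟨i, k⟩ := i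
  fin_cases i
  exacts [(hsys.law_α k).aemeasurable, (hsys.law_β k).aemeasurable, (hsys.law_γ k).aemeasurable,
    (hsys.law_δ k).aemeasurable]

lemma aemeasurable_state (hsys : IsExponentialSystem P μ ν σ τ α β γ δ) (n : ℕ) :
    AEMeasurable (state α β γ δ n) P := by
  obtain ⟨F, hF, h_eq⟩ := exists_measurable_state_eq α β γ δ n
  rw [funext h_eq]
  exact hF.comp_aemeasurable (aemeasurable_pi_lambda _ fun i => hsys.aemeasurable_entry i.1)

lemma indepFun_state_matrixAt (hsys : IsExponentialSystem P μ ν σ τ α β γ δ) (n : ℕ) :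
    IndepFun (state α β γ δ n) (matrixAt α β γ δ n) P := by
  have h_disjoint : Disjoint ((Finset.univ : Finset (Fin 4)) ×ˢ Finset.range n)
      (Finset.univ ×ˢ {n}) :=
    Finset.disjoint_product.2 (.inr (by simp))
  have h_mem (i : Fin 4) : (i, n) ∈ (Finset.univ : Finset (Fin 4)) ×ˢ {n} := by simp
  have h_rows : Measurable fun v : ↥((Finset.univ : Finset (Fin 4)) ×ˢ {n}) → ℝ =>
      ((v ⟨(0, n), h_mem 0⟩, v ⟨(1, n), h_mem 1⟩), (v ⟨(2, n), h_mem 2⟩, v ⟨(3, n), h_mem 3⟩)) := by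
    fun_prop
  obtain ⟨F, hF, h_eq⟩ := exists_measurable_state_eq α β γ δ n
  rw [funext h_eq]
  exact (hsys.indep.indepFun_finset₀ _ _ h_disjoint hsys.aemeasurable_entry).comp hF h_rows

lemma ae_monotone_max (hsys : IsExponentialSystem P μ ν σ τ α β γ δ) (hμ : 0 < μ) (hτ : 0 < τ) :
    ∀ᵐ ω ∂P, Monotone fun k => max (state α β γ δ k ω).1 (state α β γ δ k ω).2 := by
  have hα : ∀ᵐ ω ∂P, ∀ k, 0 ≤ α k ω := ae_all_iff.2 fun k =>
    ((hsys.law_α k).ae_iff (p := fun x => 0 ≤ x) (by fun_prop)).2 (ae_nonneg_expMeasure hμ)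
  have hδ : ∀ᵐ ω ∂P, ∀ k, 0 ≤ δ k ω := ae_all_iff.2 fun k =>
    ((hsys.law_δ k).ae_iff (p := fun x => 0 ≤ x) (by fun_prop)).2 (ae_nonneg_expMeasure hτ)
  filter_upwards [hα, hδ] with ω hαω hδω
  exact monotone_nat_of_le_succ fun k =>
    max_le_max (le_max_of_le_left (le_add_of_nonneg_right (hαω k)))
      (le_max_of_le_right (le_add_of_nonneg_right (hδω k)))

variable [IsProbabilityMeasure P]

lemma hasLaw_matrixAt (hsys : IsExponentialSystem P μ ν σ τ α β γ δ) (n : ℕ) :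
    HasLaw (matrixAt α β γ δ n) (matrixLaw μ ν σ τ) P := by
  have h_fst : IndepFun (α n) (β n) P :=
    hsys.indep.indepFun (i := (0, n)) (j := (1, n)) (by simp)
  have h_snd : IndepFun (γ n) (δ n) P :=
    hsys.indep.indepFun (i := (2, n)) (j := (3, n)) (by simp)
  have h_rows : IndepFun (fun ω => (α n ω, β n ω)) (fun ω => (γ n ω, δ n ω)) P :=
    hsys.indep.indepFun_prodMk_prodMk₀ hsys.aemeasurable_entry (0, n) (1, n) (2, n) (3, n)
      (by simp) (by simp) (by simp) (by simp)
  exact h_rows.hasLaw_prod (h_fst.hasLaw_prod (hsys.law_α n) (hsys.law_β n))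
    (h_snd.hasLaw_prod (hsys.law_γ n) (hsys.law_δ n))

lemma isRandomRecursion (hsys : IsExponentialSystem P μ ν σ τ α β γ δ) :
    IsRandomRecursion step (matrixLaw μ ν σ τ) P (state α β γ δ) (matrixAt α β γ δ) where
  succ _ _ := rfl
  aemeasurable := hsys.aemeasurable_state
  hasLaw := hsys.hasLaw_matrixAt
  indepFun := hsys.indepFun_state_matrixAt

theorem isLyapunovExponent_of_integral_potential_step
    (hsys : IsExponentialSystem P μ ν σ τ α β γ δ) (hμ : 0 < μ) (hν : 0 < ν) (hσ : 0 < σ)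
    (hτ : 0 < τ) {h : ℝ → ℝ} (hm : Measurable h) {C : ℝ} (hC : ∀ r, 0 ≤ r → |h r| ≤ C) {l : ℝ}
    (h_poisson : ∀ z, ∫ w, potential h (step z w) ∂matrixLaw μ ν σ τ = potential h z + l) :
    IsLyapunovExponent P α β γ δ l := by
  have := isProbabilityMeasure_matrixLaw hμ hν hσ hτ
  have h_solves := solvesPoisson_potential hm hC hμ hν hσ hτ h_poisson
  filter_upwards [hsys.ae_monotone_max hμ hτ, h_solves.ae_tendsto_sq_div measurable_step
    hsys.isRandomRecursion (memLp_const (potential h (0, 0)))] with ω h_mono h_lim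
  have h_corr : Tendsto (fun n : ℕ => h |(state α β γ δ (n ^ 2) ω).1 - (state α β γ δ (n ^ 2) ω).2|
      / (n : ℝ) ^ 2) atTop (𝓝 0) := by
    have h_inv : Tendsto (fun n : ℕ => C / (n : ℝ) ^ 2) atTop (𝓝 0) :=
      ((tendsto_pow_atTop two_ne_zero).comp tendsto_natCast_atTop_atTop).const_div_atTop C
    refine squeeze_zero_norm (fun n => ?_) h_inv
    rw [norm_div, Real.norm_eq_abs, norm_pow, RCLike.norm_natCast]
    gcongr
    exact hC _ (abs_nonneg _)
  have h_max := h_lim.sub h_corr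
  simp only [potential, add_div, add_sub_cancel_right, sub_zero] at h_max
  simpa only [one_div_mul_eq_div] using tendsto_div_of_monotone_of_tendsto_div_sq h_mono h_max

end IsExponentialSystem

end ExponentialSystem

end MaxPlus

theorem mainTheorem2 {Ω : Type*} [MeasurableSpace Ω] (P : Measure Ω) [IsProbabilityMeasure P]
    (μ ν σ τ : ℝ) (hμ : 0 < μ) (hν : 0 < ν) (hτ : τ = μ) (hσ : σ = ν)
    (α β γ δ : ℕ → Ω → ℝ) (hsys : MaxPlus.IsExponentialSystem P μ ν σ τ α β γ δ) :
    MaxPlus.IsLyapunovExponent P α β γ δ (MaxPlus.numP μ ν / MaxPlus.denQ μ ν) := by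
  subst hτ hσ
  obtain ⟨C, hC⟩ := MaxPlus.exists_abs_corrector_le hμ.le hν.le
  exact hsys.isLyapunovExponent_of_integral_potential_step hμ hν hν hμ
    (MaxPlus.measurable_corrector _ _) hC (MaxPlus.integral_potential_corrector_step hμ hν)
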